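/- Let $\mathbb K$ be a field of characteristic $0$. For $n\ge 0$ let $$\Omega_n=\frac{\mathbb K[x_0,\dots,x_n,dx_0,\dots,dx_n]}{\left(\sum_i x_i-1,\ \sum_i dx_i\right)}$$ be the graded-commutative algebra of polynomial differential forms on the affine standard simplex $\Delta^n=\{(x_0,\dots,x_n)\in\mathbb K^{n+1}: \sum_i x_i=1\}$ with vertices $e_0,\dots,e_n$ ($x_i$ has degree $0$, $dx_i$ has degree $1$). Let $\int_{\Delta^n}\colon\Omega_n\to\mathbb K$ be the linear map that vanishes on forms of degree $\ne n$ and satisfies $$\int_{\Delta^n}x_0^{k_0}\cdots x_n^{k_n}\,dx_0\wedge\dots\wedge\widehat{dx_i}\wedge\dots\wedge dx_n=(-1)^i\frac{k_0!\cdots k_n!}{(k_0+\dots+k_n+n)!}.$$ Let $\widehat\Delta^n$ be the $(n+1)$-dimensional affine standard simplex with coordinates written, in this order, $(s,t_0,\dots,t_n)$, and let $\widehat\Omega_n$ be its algebra of polynomial forms, with $\int_{\widehat\Delta^n}\colon\widehat\Omega_n\to\mathbb K$ as above. Forms on a product are identified with the graded tensor product of the algebras of forms on the factors. Fix $m\ge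 0$, let $I(n,m)$ be the set of strictly increasing maps $f\colon\{0,\dots,n\}\to\{0,\dots,m\}$, and for $f\in I(n,m)$ put $$\omega_f=n!\sum_{i=0}^n(-1)^i x_{f(i)}\,dx_{f(0)}\wedge\dots\wedge\widehat{dx_{f(i)}}\wedge\dots\wedge dx_{f(n)}\in\Omega_m .$$ Dupont's operator. For $0\le j\le m$ and $\eta\in\Omega_m$, let $ds\wedge\alpha_\eta+\beta_\eta$ with $\alpha_\eta,\beta_\eta\in\Omega_m[s]$ be the pull-back of $\eta$ along $\widehat\Delta^0\times\Delta^m\to\Delta^m$, $((s,t_0),v)\mapsto s e_j+t_0v=se_j+(1-s)v$, and let $h_{(j)}(\eta)=\int_0^1\alpha_\eta\,ds\in\Omega_m$ (integration of the coefficients, polynomials in $s$, so that $s^k\mapsto 1/(k+1)$). For $f\in I(n,m)$ let $h_f=h_{(f(n))}\circ\dots\circ h_{(f(0))}$, and let $$h_m(\eta)=\sum_{n=0}^m\sum_{f\in I(n,m)}\omega_f\wedge h_f(\eta).$$ Manetti's operator. For $f\in I(n,m)$ let $\widehat f\colon\widehat\Delta^n\times\Delta^m\to\Delta^m$, $((s,t_0,\dots,t_n),v)\mapsto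 sv+\sum_{i=0}^n t_ie_{f(i)}$, let $k_f$ be the composition $$\Omega_m\xrightarrow{\ \widehat f^{*}\ }\widehat\Omega_n\otimes\Omega_m\xrightarrow{\ \int_{\widehat\Delta^n}\otimes\,\mathrm{Id}\ }\Omega_m,$$ and let $$k_m(\eta)=\sum_{n=0}^m\sum_{f\in I(n,m)}\omega_f\wedge k_f(\eta).$$ Theorem. For every $m\in\mathbb N$, $k_m=h_m$ as linear maps $\Omega_m\to\Omega_m$. -/

import Mathlib

noncomputable section

open scoped TensorProduct DirectSum

namespace SimplexForms

/-- The relations between the generators `xᵢ` (written `.inl i`) and `dxᵢ` (written `.inr i`) of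
the algebra of polynomial forms on the standard `n`-simplex: graded commutativity, with `xᵢ` in
degree `0` and `dxᵢ` in degree `1` (in characteristic zero `dxᵢ dxᵢ = -dxᵢ dxᵢ` gives
`dxᵢ dxᵢ = 0`), and `∑ xᵢ = 1`, `∑ dxᵢ = 0`. -/
inductive Rel (K : Type*) [Field K] (n : ℕ) :
    FreeAlgebra K (Fin (n + 1) ⊕ Fin (n + 1)) → FreeAlgebra K (Fin (n + 1) ⊕ Fin (n + 1)) → Prop
  | x_comm (i j : Fin (n + 1)) :
      Rel K n (FreeAlgebra.ι K (.inl i) * FreeAlgebra.ι K (.inl j))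
        (FreeAlgebra.ι K (.inl j) * FreeAlgebra.ι K (.inl i))
  | x_dx_comm (i j : Fin (n + 1)) :
      Rel K n (FreeAlgebra.ι K (.inl i) * FreeAlgebra.ι K (.inr j))
        (FreeAlgebra.ι K (.inr j) * FreeAlgebra.ι K (.inl i))
  | dx_anticomm (i j : Fin (n + 1)) :
      Rel K n (FreeAlgebra.ι K (.inr i) * FreeAlgebra.ι K (.inr j))
        (-(FreeAlgebra.ι K (.inr j) * FreeAlgebra.ι K (.inr i)))
  | sum_x : Rel K n (∑ i, FreeAlgebra.ι K (.inl i)) 1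
  | sum_dx : Rel K n (∑ i, FreeAlgebra.ι K (.inr i)) 0

/-- The algebra `Ω_n = K[x₀, …, xₙ, dx₀, …, dxₙ] / (∑ xᵢ - 1, ∑ dxᵢ)` of polynomial differential
forms on the affine standard `n`-simplex. The product is the wedge product. -/
def Omega (K : Type*) [Field K] (n : ℕ) : Type _ := RingQuot (Rel K n)

instance (K : Type*) [Field K] (n : ℕ) : Ring (Omega K n) :=
  inferInstanceAs (Ring (RingQuot (Rel K n)))

instance (K : Type*) [Field K] (n : ℕ) : Algebra K (Omega K n) :=
  inferInstanceAs (Algebra K (RingQuot (Rel K n)))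

/-- The quotient map from the free algebra. -/
def mk (K : Type*) [Field K] (n : ℕ) :
    FreeAlgebra K (Fin (n + 1) ⊕ Fin (n + 1)) →ₐ[K] Omega K n :=
  RingQuot.mkAlgHom K (Rel K n)

theorem mk_rel {K : Type*} [Field K] {n : ℕ} {a b} (h : Rel K n a b) : mk K n a = mk K n b :=
  RingQuot.mkAlgHom_rel K h

variable {K : Type*} [Field K] {n : ℕ}

/-- The generators: `.inl i` gives `xᵢ`, `.inr i` gives `dxᵢ`. -/
def gen (a : Fin (n + 1) ⊕ Fin (n + 1)) : Omega K n :=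
  mk K n (FreeAlgebra.ι K a)

/-- The coordinate function `xᵢ`. -/
def x (i : Fin (n + 1)) : Omega K n := gen (.inl i)

/-- The differential `dxᵢ`. -/
def dx (i : Fin (n + 1)) : Omega K n := gen (.inr i)

theorem x_comm (i j : Fin (n + 1)) : (x i * x j : Omega K n) = x j * x i := by
  have h := mk_rel (Rel.x_comm (K := K) i j)
  simp only [map_mul] at h
  exact h

theorem x_dx_comm (i j : Fin (n + 1)) : (x i * dx j : Omega K n) = dx j * x i := by
  have h := mk_rel (Rel.x_dx_comm (K := K) i j)
  simp only [map_mul] at h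
  exact h

theorem dx_anticomm (i j : Fin (n + 1)) : (dx i * dx j : Omega K n) = -(dx j * dx i) := by
  have h := mk_rel (Rel.dx_anticomm (K := K) i j)
  simp only [map_mul, map_neg] at h
  exact h

theorem sum_x : (∑ i, x i : Omega K n) = 1 := by
  have h := mk_rel (Rel.sum_x (K := K) (n := n))
  simp only [map_sum, map_one] at h
  exact h

theorem sum_dx : (∑ i, dx i : Omega K n) = 0 := by
  have h := mk_rel (Rel.sum_dx (K := K) (n := n))
  simp only [map_sum, map_zero] at h
  exact h

/-- The algebra map out of `Ω_n` with prescribed values on the generators. -/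
def lift {B : Type*} [Ring B] [Algebra K B] (X D : Fin (n + 1) → B)
    (h₁ : ∀ i j, X i * X j = X j * X i) (h₂ : ∀ i j, X i * D j = D j * X i)
    (h₃ : ∀ i j, D i * D j = -(D j * D i)) (h₄ : ∑ i, X i = 1) (h₅ : ∑ i, D i = 0) :
    Omega K n →ₐ[K] B :=
  RingQuot.liftAlgHom K ⟨FreeAlgebra.lift K (Sum.elim X D), by
    intro a b h
    cases h with
    | x_comm i j => simpa using h₁ i j
    | x_dx_comm i j => simpa using h₂ i j
    | dx_anticomm i j => simpa using h₃ i j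
    | sum_x => simpa using h₄
    | sum_dx => simpa using h₅⟩

section

variable {B : Type*} [Ring B] [Algebra K B] (X D : Fin (n + 1) → B)
    (h₁ : ∀ i j, X i * X j = X j * X i) (h₂ : ∀ i j, X i * D j = D j * X i)
    (h₃ : ∀ i j, D i * D j = -(D j * D i)) (h₄ : ∑ i, X i = 1) (h₅ : ∑ i, D i = 0)

theorem lift_gen (a : Fin (n + 1) ⊕ Fin (n + 1)) :
    lift X D h₁ h₂ h₃ h₄ h₅ (gen a : Omega K n) = Sum.elim X D a := by
  rw [lift, gen]
  exact (RingQuot.liftAlgHom_mkAlgHom_apply K _ _ _).trans (by simp)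

theorem lift_x (i : Fin (n + 1)) : lift X D h₁ h₂ h₃ h₄ h₅ (x i : Omega K n) = X i :=
  lift_gen X D h₁ h₂ h₃ h₄ h₅ _

theorem lift_dx (i : Fin (n + 1)) : lift X D h₁ h₂ h₃ h₄ h₅ (dx i : Omega K n) = D i :=
  lift_gen X D h₁ h₂ h₃ h₄ h₅ _

end

theorem algHom_ext {B : Type*} [Ring B] [Algebra K B] {φ ψ : Omega K n →ₐ[K] B}
    (h : ∀ a, φ (gen a) = ψ (gen a)) : φ = ψ := by
  apply RingQuot.ringQuot_ext'
  apply FreeAlgebra.hom_ext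
  funext a
  exact h a

variable (K n) in
/-- The space `Ω_n^p` of `p`-forms, spanned by the products of generators
with exactly `p` factors of the form `dxᵢ`. -/
def degreePart (p : ℕ) : Submodule K (Omega K n) :=
  Submodule.span K {ω | ∃ w : List (Fin (n + 1) ⊕ Fin (n + 1)),
    w.countP Sum.isRight = p ∧ (w.map gen).prod = ω}

theorem word_mem (w : List (Fin (n + 1) ⊕ Fin (n + 1))) :
    (w.map gen).prod ∈ degreePart K n (w.countP Sum.isRight) :=
  Submodule.subset_span ⟨w, rfl, rfl⟩

theorem x_mem (i : Fin (n + 1)) : x i ∈ degreePart K n 0 :=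
  Submodule.subset_span ⟨[.inl i], by simp, by simp [x]⟩

theorem dx_mem (i : Fin (n + 1)) : dx i ∈ degreePart K n 1 :=
  Submodule.subset_span ⟨[.inr i], by simp, by simp [dx]⟩

instance : SetLike.GradedMonoid (degreePart K n) where
  one_mem := Submodule.subset_span ⟨[], by simp, by simp⟩
  mul_mem := by
    intro p q a b ha hb
    have key : degreePart K n p * degreePart K n q ≤ degreePart K n (p + q) := by
      rw [degreePart, degreePart, Submodule.span_mul_span, Submodule.span_le]
      rintro _ ⟨_, ⟨v, hv, rfl⟩, _, ⟨w, hw, rfl⟩, rfl⟩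
      exact Submodule.subset_span ⟨v ++ w, by simp [hv, hw], by simp⟩
    exact key (Submodule.mul_mem_mul ha hb)

/-- The decomposition of a form into its homogeneous components. -/
def decomposeHom : Omega K n →ₐ[K] ⨁ p, degreePart K n p :=
  lift (fun i => DirectSum.of (fun p => degreePart K n p) 0 ⟨x i, x_mem i⟩)
    (fun i => DirectSum.of (fun p => degreePart K n p) 1 ⟨dx i, dx_mem i⟩)
    (fun i j => by
      rw [DirectSum.of_mul_of, DirectSum.of_mul_of]
      exact DirectSum.of_eq_of_gradedMonoid_eq (Sigma.subtype_ext rfl (x_comm i j)))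
    (fun i j => by
      rw [DirectSum.of_mul_of, DirectSum.of_mul_of]
      exact DirectSum.of_eq_of_gradedMonoid_eq (Sigma.subtype_ext rfl (x_dx_comm i j)))
    (fun i j => by
      rw [DirectSum.of_mul_of, DirectSum.of_mul_of, ← map_neg]
      exact DirectSum.of_eq_of_gradedMonoid_eq (Sigma.subtype_ext rfl (dx_anticomm i j)))
    (by
      rw [← map_sum]
      exact DirectSum.of_eq_of_gradedMonoid_eq (Sigma.subtype_ext rfl (by
        exact (AddSubmonoidClass.coe_finsetSum _ _).trans sum_x)))
    (by
      rw [← map_sum, ← map_zero (DirectSum.of (fun p => degreePart K n p) 1)]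
      exact DirectSum.of_eq_of_gradedMonoid_eq (Sigma.subtype_ext rfl (by
        exact (AddSubmonoidClass.coe_finsetSum _ _).trans sum_dx)))

theorem decomposeHom_gen (a : Fin (n + 1) ⊕ Fin (n + 1)) (p : ℕ) (h : gen a ∈ degreePart K n p)
    (hp : p = [a].countP Sum.isRight) :
    decomposeHom (gen a : Omega K n) = DirectSum.of (fun p => degreePart K n p) p ⟨gen a, h⟩ := by
  subst hp
  rw [decomposeHom, lift_gen]
  cases a <;> rfl

theorem decomposeHom_word (w : List (Fin (n + 1) ⊕ Fin (n + 1))) :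
    decomposeHom ((w.map gen).prod : Omega K n) =
      DirectSum.of (fun p => degreePart K n p) _ ⟨_, word_mem w⟩ := by
  induction w with
  | nil => simp only [List.map_nil, List.prod_nil, map_one]; rfl
  | cons a w ih =>
    have ha : gen a ∈ degreePart K n ([a].countP Sum.isRight) := by
      simpa using word_mem (K := K) [a]
    simp only [List.map_cons, List.prod_cons, map_mul]
    rw [ih, decomposeHom_gen a _ ha rfl, DirectSum.of_mul_of]
    refine DirectSum.of_eq_of_gradedMonoid_eq (Sigma.subtype_ext ?_ rfl)
    change _ + _ = List.countP _ ([a] ++ w)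
    rw [List.countP_append]

/-- `Ω_n` is graded by the degree of forms. -/
instance : GradedAlgebra (degreePart K n) :=
  GradedAlgebra.ofAlgHom _ decomposeHom
    (algHom_ext fun a => by
      have ha : gen a ∈ degreePart K n ([a].countP Sum.isRight) := by
        simpa using word_mem (K := K) [a]
      rw [AlgHom.comp_apply, decomposeHom_gen a _ ha rfl, DirectSum.coeAlgHom_of]
      rfl)
    (by
      rintro p ⟨ω, hω⟩
      induction hω using Submodule.span_induction with
      | mem ω h =>
        obtain ⟨w, rfl, rfl⟩ := h
        exact decomposeHom_word w
      | zero =>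
        rw [map_zero]; exact (map_zero _).symm
      | add a b ha hb iha ihb =>
        change decomposeHom (a + b) = _
        rw [map_add, iha, ihb, ← map_add]; rfl
      | smul c a ha iha =>
        change decomposeHom (c • a) = _
        rw [map_smul, iha]
        exact ((DirectSum.lof K ℕ (fun p => degreePart K n p) p).map_smul c _).symm)


variable {N m : ℕ}

/-- Let `P(v)` be the point `v` of the `m`-simplex if `P = none`, and the vertex `e_j` if
`P = some j`. This is the `i`-th coordinate of `P(v)`, as a function of `v`. -/
def pointCoord (P : Option (Fin (m + 1))) (i : Fin (m + 1)) : Omega K m :=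
  P.elim (x i) fun j => if i = j then 1 else 0

/-- The differential of the `i`-th coordinate of `P(v)`. -/
def pointDiff (P : Option (Fin (m + 1))) (i : Fin (m + 1)) : Omega K m :=
  P.elim (dx i) fun _ => 0

theorem pointCoord_mem (P : Option (Fin (m + 1))) (i : Fin (m + 1)) :
    pointCoord P i ∈ degreePart K m 0 := by
  cases P with
  | none => exact x_mem i
  | some j =>
    simp only [pointCoord, Option.elim_some]
    split_ifs
    · exact SetLike.GradedOne.one_mem
    · exact Submodule.zero_mem _

theorem pointDiff_mem (P : Option (Fin (m + 1))) (i : Fin (m + 1)) :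
    pointDiff P i ∈ degreePart K m 1 := by
  cases P with
  | none => exact dx_mem i
  | some j => exact Submodule.zero_mem _

theorem pointCoord_comm (P Q : Option (Fin (m + 1))) (i j : Fin (m + 1)) :
    (pointCoord P i * pointCoord Q j : Omega K m) = pointCoord Q j * pointCoord P i := by
  cases P with
  | none => cases Q <;> simp [pointCoord, x_comm i j]
  | some a => simp only [pointCoord, Option.elim_some]; split_ifs <;> simp

theorem pointCoord_pointDiff_comm (P Q : Option (Fin (m + 1))) (i j : Fin (m + 1)) :
    (pointCoord P i * pointDiff Q j : Omega K m) = pointDiff Q j * pointCoord P i := by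
  cases P <;> cases Q <;> simp [pointCoord, pointDiff, x_dx_comm i j]

theorem pointDiff_anticomm (P Q : Option (Fin (m + 1))) (i j : Fin (m + 1)) :
    (pointDiff P i * pointDiff Q j : Omega K m) = -(pointDiff Q j * pointDiff P i) := by
  cases P <;> cases Q <;> simp [pointDiff, dx_anticomm i j]

theorem sum_pointCoord (P : Option (Fin (m + 1))) : (∑ i, pointCoord P i : Omega K m) = 1 := by
  cases P with
  | none => exact sum_x
  | some j => simp [pointCoord]

theorem sum_pointDiff (P : Option (Fin (m + 1))) : (∑ i, pointDiff P i : Omega K m) = 0 := by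
  cases P with
  | none => exact sum_dx
  | some j => simp [pointDiff]

variable (K N m) in
/-- The tensor product `Ω_N ⊗ Ω_m` of graded algebras, that is, the polynomial forms on the product
of the two simplices: `(a ⊗ b)(a' ⊗ b') = (-1)^(deg b * deg a') (a a') ⊗ (b b')`. -/
abbrev ProdForms : Type _ := degreePart K N ᵍ⊗[K] degreePart K m

theorem tmul_mul_tmul {p q : ℕ} (a a' : Omega K N) (b b' : Omega K m)
    (hb : b ∈ degreePart K m p) (ha' : a' ∈ degreePart K N q) :
    (a ᵍ⊗ₜ[K] b * a' ᵍ⊗ₜ[K] b' : ProdForms K N m) =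
      (-1 : ℤˣ) ^ (p * q) • ((a * a') ᵍ⊗ₜ[K] (b * b')) :=
  GradedTensorProduct.tmul_coe_mul_coe_tmul (degreePart K N) (degreePart K m) a ⟨b, hb⟩ ⟨a', ha'⟩ b'

/-- The `i`-th coordinate of `∑ₐ yₐ Pₐ(v)`, as a function of `(y, v)` in the product of the
`N`-simplex and the `m`-simplex. -/
def joinCoord (P : Fin (N + 1) → Option (Fin (m + 1))) (i : Fin (m + 1)) : ProdForms K N m :=
  ∑ a, x a ᵍ⊗ₜ[K] pointCoord (P a) i

/-- The differential of `joinCoord P i`, by the Leibniz rule. -/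
def joinDiff (P : Fin (N + 1) → Option (Fin (m + 1))) (i : Fin (m + 1)) : ProdForms K N m :=
  ∑ a, (dx a ᵍ⊗ₜ[K] pointCoord (P a) i + x a ᵍ⊗ₜ[K] pointDiff (P a) i)

theorem neg_tmul' (a : Omega K N) (b : Omega K m) :
    ((-a) ᵍ⊗ₜ[K] b : ProdForms K N m) = -(a ᵍ⊗ₜ[K] b) := by
  rw [GradedTensorProduct.tmul, TensorProduct.neg_tmul, map_neg]

theorem tmul_neg' (a : Omega K N) (b : Omega K m) :
    (a ᵍ⊗ₜ[K] (-b) : ProdForms K N m) = -(a ᵍ⊗ₜ[K] b) := by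
  rw [GradedTensorProduct.tmul, TensorProduct.tmul_neg, map_neg]

theorem joinCoord_comm (P : Fin (N + 1) → Option (Fin (m + 1))) (i j : Fin (m + 1)) :
    (joinCoord P i * joinCoord P j : ProdForms K N m) = joinCoord P j * joinCoord P i := by
  refine Commute.sum_left _ _ _ fun a _ => Commute.sum_right _ _ _ fun b _ => ?_
  rw [Commute, SemiconjBy, tmul_mul_tmul _ _ _ _ (pointCoord_mem _ _) (x_mem _),
    tmul_mul_tmul _ _ _ _ (pointCoord_mem _ _) (x_mem _), x_comm, pointCoord_comm]

theorem joinCoord_joinDiff_comm (P : Fin (N + 1) → Option (Fin (m + 1))) (i j : Fin (m + 1)) :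
    (joinCoord P i * joinDiff P j : ProdForms K N m) = joinDiff P j * joinCoord P i := by
  refine Commute.sum_left _ _ _ fun a _ => Commute.sum_right _ _ _ fun b _ => ?_
  refine Commute.add_right ?_ ?_
  · rw [Commute, SemiconjBy, tmul_mul_tmul _ _ _ _ (pointCoord_mem _ _) (dx_mem _),
      tmul_mul_tmul _ _ _ _ (pointCoord_mem _ _) (x_mem _), x_dx_comm, pointCoord_comm]
  · rw [Commute, SemiconjBy, tmul_mul_tmul _ _ _ _ (pointCoord_mem _ _) (x_mem _),
      tmul_mul_tmul _ _ _ _ (pointDiff_mem _ _) (x_mem _), x_comm, pointCoord_pointDiff_comm]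

theorem joinDiff_anticomm (P : Fin (N + 1) → Option (Fin (m + 1))) (i j : Fin (m + 1)) :
    (joinDiff P i * joinDiff P j : ProdForms K N m) = -(joinDiff P j * joinDiff P i) := by
  rw [joinDiff, joinDiff, Finset.sum_mul_sum, Finset.sum_mul_sum, Finset.sum_comm,
    ← Finset.sum_neg_distrib]
  refine Finset.sum_congr rfl fun b _ => ?_
  rw [← Finset.sum_neg_distrib]
  refine Finset.sum_congr rfl fun a _ => ?_
  rw [mul_add, add_mul, add_mul, mul_add, add_mul, add_mul,
    tmul_mul_tmul _ _ _ _ (pointCoord_mem _ _) (dx_mem _),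
    tmul_mul_tmul _ _ _ _ (pointCoord_mem _ _) (x_mem _),
    tmul_mul_tmul _ _ _ _ (pointDiff_mem _ _) (dx_mem _),
    tmul_mul_tmul _ _ _ _ (pointDiff_mem _ _) (x_mem _),
    tmul_mul_tmul _ _ _ _ (pointCoord_mem _ _) (dx_mem _),
    tmul_mul_tmul _ _ _ _ (pointCoord_mem _ _) (x_mem _),
    tmul_mul_tmul _ _ _ _ (pointDiff_mem _ _) (dx_mem _),
    tmul_mul_tmul _ _ _ _ (pointDiff_mem _ _) (x_mem _),
    dx_anticomm a b, x_dx_comm a b, ← x_dx_comm b a, x_comm a b,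
    pointCoord_comm (P a) (P b), ← pointCoord_pointDiff_comm (P b) (P a),
    pointCoord_pointDiff_comm (P a) (P b), pointDiff_anticomm (P a) (P b), neg_tmul', tmul_neg']
  simp
  abel

theorem sum_joinCoord (P : Fin (N + 1) → Option (Fin (m + 1))) :
    (∑ i, joinCoord P i : ProdForms K N m) = 1 := by
  simp only [joinCoord]
  rw [Finset.sum_comm]
  simp only [GradedTensorProduct.tmul, ← map_sum, ← TensorProduct.tmul_sum, sum_pointCoord,
    ← TensorProduct.sum_tmul, sum_x]
  rfl

theorem sum_joinDiff (P : Fin (N + 1) → Option (Fin (m + 1))) :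
    (∑ i, joinDiff P i : ProdForms K N m) = 0 := by
  simp only [joinDiff]
  rw [Finset.sum_comm]
  simp only [GradedTensorProduct.tmul, Finset.sum_add_distrib, ← map_sum, ← TensorProduct.tmul_sum,
    sum_pointCoord, sum_pointDiff, ← TensorProduct.sum_tmul, sum_dx, TensorProduct.zero_tmul,
    TensorProduct.tmul_zero, map_zero, add_zero]

variable (K) in
/-- The pull-back of forms `Ω_m → Ω_N ⊗ Ω_m` along the affine map `(y, v) ↦ ∑ₐ yₐ Pₐ(v)` from the
product of the `N`-simplex and the `m`-simplex to the `m`-simplex. -/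
def joinPullback (P : Fin (N + 1) → Option (Fin (m + 1))) : Omega K m →ₐ[K] ProdForms K N m :=
  lift (joinCoord P) (joinDiff P) (joinCoord_comm P) (joinCoord_joinDiff_comm P)
    (joinDiff_anticomm P) (sum_joinCoord P) (sum_joinDiff P)

/-- The map `φ ⊗ id : Ω_N ⊗ Ω_m → K ⊗ Ω_m = Ω_m`. -/
def contractLeft (φ : Omega K N →ₗ[K] K) : ProdForms K N m →ₗ[K] Omega K m :=
  (TensorProduct.lid K (Omega K m)).toLinearMap ∘ₗ TensorProduct.map φ LinearMap.id ∘ₗ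
    (GradedTensorProduct.of K (degreePart K N) (degreePart K m)).symm.toLinearMap


variable (K n) in
/-- The coordinates `x₀, …, xₙ` on the `n`-simplex written in the affine coordinates `x₁, …, xₙ`. -/
def localCoord : Fin (n + 1) → MvPolynomial (Fin n) K :=
  Fin.cons (1 - ∑ j, MvPolynomial.X j) MvPolynomial.X

variable (K n) in
/-- The differentials `dx₀, …, dxₙ` written in the basis `dx₁, …, dxₙ`. -/
def localDiff : Fin (n + 1) → Fin n → MvPolynomial (Fin n) K :=
  Fin.cons (-∑ j, Pi.single j 1) fun j => Pi.single j 1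

variable (K n) in
/-- A form on the `n`-simplex written in the affine coordinates `x₁, …, xₙ`. -/
def chart :
    Omega K n →ₐ[K] ExteriorAlgebra (MvPolynomial (Fin n) K) (Fin n → MvPolynomial (Fin n) K) :=
  lift (fun i => algebraMap _ _ (localCoord K n i))
    (fun i => ExteriorAlgebra.ι (MvPolynomial (Fin n) K) (localDiff K n i))
    (fun _ _ => Algebra.commutes _ _) (fun _ _ => Algebra.commutes _ _)
    (fun _ _ => eq_neg_of_add_eq_zero_left (ExteriorAlgebra.ι_add_mul_swap _ _))
    (by rw [← map_sum, Fin.sum_univ_succ]; simp [localCoord])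
    (by rw [← map_sum, Fin.sum_univ_succ]; simp [localDiff])

variable (K n) in
/-- The coefficient of `dx₁ ∧ … ∧ dxₙ`. -/
def topCoeff :
    ExteriorAlgebra (MvPolynomial (Fin n) K) (Fin n → MvPolynomial (Fin n) K)
      →ₗ[MvPolynomial (Fin n) K] MvPolynomial (Fin n) K :=
  ExteriorAlgebra.liftAlternating (Pi.single n Matrix.detRowAlternating)

variable (K n) in
/-- The integral of `P dx₁ ∧ … ∧ dxₙ` over the `n`-simplex, for a polynomial `P` in `x₁, …, xₙ`. -/
def polyIntegral : MvPolynomial (Fin n) K →ₗ[K] K :=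
  (MvPolynomial.basisMonomials (Fin n) K).constr K fun k =>
    (∏ j, ((k j).factorial : K)) / ((∑ j, k j + n).factorial : K)

variable (K n) in
/-- The integral of forms over the `n`-simplex. It is characterized by `integral_eq_zero` and
`integral_monomial`. -/
def integral : Omega K n →ₗ[K] K :=
  polyIntegral K n ∘ₗ (topCoeff K n).restrictScalars K ∘ₗ (chart K n).toLinearMap

theorem chart_mem {p : ℕ} {ω : Omega K n} (h : ω ∈ degreePart K n p) :
    chart K n ω ∈ ⋀[MvPolynomial (Fin n) K]^p (Fin n → MvPolynomial (Fin n) K) := by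
  induction h using Submodule.span_induction with
  | mem ω h =>
    obtain ⟨w, rfl, rfl⟩ := h
    induction w with
    | nil =>
      simp only [List.map_nil, List.prod_nil, map_one, List.countP_nil]
      exact SetLike.GradedOne.one_mem (A := fun i : ℕ ↦ ⋀[MvPolynomial (Fin n) K]^i (Fin n → MvPolynomial (Fin n) K))
    | cons a w ih =>
      rw [List.map_cons, List.prod_cons, map_mul, ← List.singleton_append, List.countP_append]
      refine SetLike.GradedMul.mul_mem (A := fun i : ℕ ↦ ⋀[MvPolynomial (Fin n) K]^i (Fin n → MvPolynomial (Fin n) K)) ?_ ih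
      rw [chart, lift_gen]
      cases a with
      | inl i => exact SetLike.algebraMap_mem_graded (fun i : ℕ ↦ ⋀[MvPolynomial (Fin n) K]^i (Fin n → MvPolynomial (Fin n) K)) _
      | inr i => simp
  | zero => rw [map_zero]; exact Submodule.zero_mem _
  | add a b _ _ ha hb => rw [map_add]; exact Submodule.add_mem _ ha hb
  | smul c a _ ha =>
    rw [map_smul, ← algebraMap_smul (MvPolynomial (Fin n) K) c (chart K n a)]
    exact Submodule.smul_mem _ _ ha

/-- The integral of a form of degree `p ≠ n` vanishes. -/
theorem integral_eq_zero {p : ℕ} (hp : p ≠ n) {ω : Omega K n} (h : ω ∈ degreePart K n p) :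
    integral K n ω = 0 := by
  have h' := chart_mem h
  rw [← exteriorPower.ιMulti_span_fixedDegree] at h'
  have : topCoeff K n (chart K n ω) = 0 := by
    generalize chart K n ω = c at h'
    induction h' using Submodule.span_induction with
    | mem ω h =>
      obtain ⟨v, rfl⟩ := h
      rw [topCoeff, ExteriorAlgebra.liftAlternating_apply_ιMulti, Pi.single_eq_of_ne hp]
      rfl
    | zero => exact map_zero _
    | add a b _ _ ha hb => rw [map_add, ha, hb, add_zero]
    | smul c a _ ha => rw [map_smul, ha, smul_zero]
  change polyIntegral K n (topCoeff K n (chart K n ω)) = 0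
  rw [this, map_zero]

theorem polyIntegral_monomial (k : Fin n →₀ ℕ) :
    polyIntegral K n (MvPolynomial.monomial k 1) =
      (∏ j, ((k j).factorial : K)) / ((∑ j, k j + n).factorial : K) := by
  have h := (MvPolynomial.basisMonomials (Fin n) K).constr_basis K (fun k =>
    (∏ j, ((k j).factorial : K)) / ((∑ j, k j + n).factorial : K)) k
  rwa [MvPolynomial.coe_basisMonomials] at h

theorem polyIntegral_pow [CharZero K] (a : ℕ) (k : Fin n →₀ ℕ) :
    polyIntegral K n ((1 - ∑ j, MvPolynomial.X j) ^ a * MvPolynomial.monomial k 1) =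
      (a.factorial * ∏ j, ((k j).factorial : K)) / ((a + ∑ j, k j + n).factorial : K) := by
  induction a generalizing k with
  | zero => simp [polyIntegral_monomial]
  | succ a ih =>
    have e : ((1 - ∑ j, MvPolynomial.X j) ^ (a + 1) * MvPolynomial.monomial k (1 : K)) =
        (1 - ∑ j, MvPolynomial.X j) ^ a * MvPolynomial.monomial k 1 -
          ∑ j, (1 - ∑ j, MvPolynomial.X j) ^ a * MvPolynomial.monomial (k + Finsupp.single j 1) 1 := by
      have : ∀ j, MvPolynomial.monomial (k + Finsupp.single j 1) (1 : K) =
          MvPolynomial.X j * MvPolynomial.monomial k 1 := by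
        intro j
        rw [MvPolynomial.X, MvPolynomial.monomial_mul, add_comm, one_mul]
      simp only [this]
      rw [← Finset.mul_sum, ← Finset.sum_mul]
      ring
    have hs : ∀ j : Fin n, ∑ i, (k + Finsupp.single j 1 : Fin n →₀ ℕ) i = ∑ i, k i + 1 := by
      intro j
      simp [Finset.sum_add_distrib, Finsupp.single_apply]
    have hp : ∀ j : Fin n, ∏ i, (((k + Finsupp.single j 1 : Fin n →₀ ℕ) i).factorial : K) =
        (k j + 1) * ∏ i, ((k i).factorial : K) := by
      intro j
      rw [← Finset.mul_prod_erase _ _ (Finset.mem_univ j),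
        ← Finset.mul_prod_erase _ (fun i => ((k i).factorial : K)) (Finset.mem_univ j)]
      have : ∏ i ∈ Finset.univ.erase j, (((k + Finsupp.single j 1 : Fin n →₀ ℕ) i).factorial : K) =
          ∏ i ∈ Finset.univ.erase j, ((k i).factorial : K) := by
        refine Finset.prod_congr rfl fun i hi => ?_
        rw [Finsupp.add_apply, Finsupp.single_eq_of_ne (Finset.ne_of_mem_erase hi), add_zero]
      rw [this]
      simp [Nat.factorial_succ]
      ring
    rw [e, map_sub, map_sum, ih]
    simp only [ih, hs, hp]
    rw [← Finset.sum_div, ← Finset.mul_sum, ← Finset.sum_mul, Finset.sum_add_distrib,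
      show a + (∑ i, k i + 1) + n = (a + ∑ i, k i + n) + 1 by ring,
      show a + 1 + ∑ i, k i + n = (a + ∑ i, k i + n) + 1 by ring]
    have h0 : ((a + ∑ i, k i + n).factorial : K) ≠ 0 := by exact_mod_cast Nat.factorial_ne_zero _
    have h1 : ((a + ∑ i, k i + n : ℕ) : K) + 1 ≠ 0 := Nat.cast_add_one_ne_zero _
    simp only [Nat.factorial_succ]
    push_cast at h1 ⊢
    simp only [Finset.sum_const, Finset.card_univ, Fintype.card_fin, nsmul_eq_mul, mul_one]
    field_simp
    ring

theorem det_localDiff (i : Fin (n + 1)) :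
    Matrix.det (fun j => localDiff K n (i.succAbove j)) = (-1) ^ (i : ℕ) := by
  have h := Matrix.submatrix_succAbove_det_eq_negOnePow_submatrix_succAbove_det
    (Matrix.of (localDiff K n)) (by
      change ∑ j, localDiff K n j = 0
      rw [Fin.sum_univ_succ]; simp [localDiff]) i 0
  have h0 : ((Matrix.of (localDiff K n)).submatrix (Fin.succAbove 0) id) = 1 := by
    ext a b
    simp [localDiff, Matrix.one_apply, Pi.single_apply, eq_comm]
  rw [h0, Matrix.det_one] at h
  refine Eq.trans ?_ (h.trans ?_)
  · rfl
  · simp [Int.negOnePow, Units.smul_def]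

/-- The integral of `x₀^k₀ ⋯ xₙ^kₙ dx₀ ∧ … ∧ dxᵢ₋₁ ∧ dxᵢ₊₁ ∧ … ∧ dxₙ`. -/
theorem integral_monomial [CharZero K] (k : Fin (n + 1) → ℕ) (i : Fin (n + 1)) :
    integral K n ((List.ofFn fun j => x j ^ k j).prod *
        (List.ofFn fun j : Fin n => dx (i.succAbove j)).prod) =
      (-1) ^ (i : ℕ) * (∏ j, ((k j).factorial : K)) / ((∑ j, k j + n).factorial : K) := by
  have hx : chart K n (List.ofFn fun j => x j ^ k j).prod =
      algebraMap (MvPolynomial (Fin n) K) _ ((1 - ∑ j, MvPolynomial.X j) ^ k 0 *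
        MvPolynomial.monomial (Finsupp.equivFunOnFinite.symm fun j : Fin n => k j.succ) 1) := by
    rw [map_list_prod, List.map_ofFn, MvPolynomial.monomial_eq, Finsupp.prod_fintype _ _ (by simp)]
    have : (⇑(chart K n) ∘ fun j => x j ^ k j) = (⇑(algebraMap (MvPolynomial (Fin n) K)
        (ExteriorAlgebra (MvPolynomial (Fin n) K) (Fin n → MvPolynomial (Fin n) K))) ∘
          fun j => localCoord K n j ^ k j) := by
      funext j
      simp only [Function.comp, map_pow, chart, lift_x]
    rw [this, ← List.map_ofFn, ← map_list_prod, List.prod_ofFn, Fin.prod_univ_succ]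
    simp [localCoord]
  have hd : chart K n (List.ofFn fun j : Fin n => dx (i.succAbove j)).prod =
      ExteriorAlgebra.ιMulti (MvPolynomial (Fin n) K) n fun j => localDiff K n (i.succAbove j) := by
    rw [map_list_prod, List.map_ofFn, ExteriorAlgebra.ιMulti_apply]
    congr 2
    funext j
    simp only [Function.comp, chart, lift_dx]
  change polyIntegral K n (topCoeff K n (chart K n _)) = _
  rw [map_mul, hx, hd, ← Algebra.smul_def, map_smul, topCoeff,
    ExteriorAlgebra.liftAlternating_apply_ιMulti, Pi.single_eq_same]
  change polyIntegral K n (_ • Matrix.det _) = _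
  rw [det_localDiff, smul_eq_mul, mul_comm, ← map_one MvPolynomial.C, ← map_neg, ← map_pow,
    ← MvPolynomial.smul_eq_C_mul, map_smul, map_one, polyIntegral_pow, Fin.prod_univ_succ, Fin.sum_univ_succ,
    smul_eq_mul, ← mul_div_assoc]
  simp


variable (K) in
/-- Forms on the `1`-simplex with coordinates `(s, t₀)` written as `q(s) + p(s) ds`, where
`t₀ = 1 - s`, `dt₀ = -ds` and `ds` is the square-zero element `ε`. -/
def intervalChart : Omega K 1 →ₐ[K] DualNumber (Polynomial K) :=
  lift ![TrivSqZeroExt.inl Polynomial.X, TrivSqZeroExt.inl (1 - Polynomial.X)]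
    ![TrivSqZeroExt.inr 1, TrivSqZeroExt.inr (-1)]
    (fun _ _ => mul_comm _ _) (fun _ _ => mul_comm _ _)
    (fun i j => by fin_cases i <;> fin_cases j <;> simp)
    (by simp [Fin.sum_univ_succ])
    (by simp [Fin.sum_univ_succ])

variable (K) in
/-- The polynomial `q` in the expression `q(s) + p(s) ds` of a form on the `1`-simplex. -/
def constCoeff : Omega K 1 →ₗ[K] Polynomial K :=
  (TrivSqZeroExt.fstHom K (Polynomial K) (Polynomial K)).toLinearMap ∘ₗ (intervalChart K).toLinearMap

variable (K) in
/-- The polynomial `p` in the expression `q(s) + p(s) ds` of a form on the `1`-simplex. -/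
def dsCoeff : Omega K 1 →ₗ[K] Polynomial K :=
  (TrivSqZeroExt.sndHom (Polynomial K) (Polynomial K)).restrictScalars K ∘ₗ (intervalChart K).toLinearMap

theorem dx_mul_self [CharZero K] (i : Fin (n + 1)) : (dx i * dx i : Omega K n) = 0 := by
  have h : (2 : K) • (dx i * dx i : Omega K n) = 0 := by
    rw [two_smul]
    exact eq_neg_iff_add_eq_zero.mp (dx_anticomm i i)
  exact (smul_eq_zero.mp h).resolve_left two_ne_zero

theorem commute_dx_aeval (p : Polynomial K) :
    Commute (dx 0 : Omega K 1) (Polynomial.aeval (x 0) p) := by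
  induction p using Polynomial.induction_on' with
  | add p q hp hq => rw [map_add]; exact hp.add_right hq
  | monomial k a =>
    rw [Polynomial.aeval_monomial]
    have h : Commute (dx 0 : Omega K 1) (x 0) := (x_dx_comm 0 0).symm
    exact (Algebra.commute_algebraMap_right a _).mul_right (h.pow_right k)

theorem eq_ds_mul_add [CharZero K] (ω : Omega K 1) :
    dx 0 * Polynomial.aeval (x 0) (dsCoeff K ω) + Polynomial.aeval (x 0) (constCoeff K ω) = ω := by
  have h0 : (dx 0 + dx 1 : Omega K 1) = 0 := by simpa [Fin.sum_univ_succ] using sum_dx (K := K) (n := 1)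
  have h1 : (x 0 + x 1 : Omega K 1) = 1 := by simpa [Fin.sum_univ_succ] using sum_x (K := K) (n := 1)
  have h : (DualNumber.lift ⟨(Polynomial.aeval (R := K) (x 0 : Omega K 1), dx 0), dx_mul_self 0,
      commute_dx_aeval⟩).comp (intervalChart K) = AlgHom.id K _ := by
    refine algHom_ext fun a => ?_
    rw [AlgHom.comp_apply, intervalChart, lift_gen, DualNumber.lift_apply_apply, AlgHom.id_apply]
    rcases a with i | i <;> fin_cases i
    · simp [x]
    · simp only [Sum.elim_inl]
      change _ = x 1
      simp [← h1]
    · simp [dx]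
    · simp only [Sum.elim_inr]
      change _ = dx 1
      simp [← eq_neg_of_add_eq_zero_right h0]
  have h2 := DFunLike.congr_fun h ω
  rw [AlgHom.comp_apply, DualNumber.lift_apply_apply, add_comm] at h2
  rw [commute_dx_aeval]
  exact h2

variable (K m) in
/-- The form `α ∈ Ω_m[s] = K[s] ⊗ Ω_m` in the decomposition `ω = ds ∧ α + β`. -/
def alphaPart : ProdForms K 1 m →ₗ[K] Polynomial K ⊗[K] Omega K m :=
  TensorProduct.map (dsCoeff K) LinearMap.id ∘ₗ
    (GradedTensorProduct.of K (degreePart K 1) (degreePart K m)).symm.toLinearMap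

variable (K m) in
/-- The form `β ∈ Ω_m[s] = K[s] ⊗ Ω_m` in the decomposition `ω = ds ∧ α + β`. -/
def betaPart : ProdForms K 1 m →ₗ[K] Polynomial K ⊗[K] Omega K m :=
  TensorProduct.map (constCoeff K) LinearMap.id ∘ₗ
    (GradedTensorProduct.of K (degreePart K 1) (degreePart K m)).symm.toLinearMap

variable (K m) in
/-- The inclusion of `Ω_m[s] = K[s] ⊗ Ω_m` into the forms on the product. -/
def ofPoly : Polynomial K ⊗[K] Omega K m →ₗ[K] ProdForms K 1 m :=
  (GradedTensorProduct.of K (degreePart K 1) (degreePart K m)).toLinearMap ∘ₗ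
    TensorProduct.map (Polynomial.aeval (x 0)).toLinearMap LinearMap.id

theorem aeval_mem (p : Polynomial K) : Polynomial.aeval (x 0) p ∈ degreePart K 1 0 := by
  induction p using Polynomial.induction_on' with
  | add p q hp hq => rw [map_add]; exact Submodule.add_mem _ hp hq
  | monomial k a =>
    rw [Polynomial.aeval_monomial, ← Algebra.smul_def]
    refine Submodule.smul_mem _ _ ?_
    simpa using SetLike.pow_mem_graded k (x_mem (K := K) (0 : Fin 2))

/-- The decomposition `ω = ds ∧ α + β`. -/
theorem eq_ds_alpha_add_beta [CharZero K] (ω : ProdForms K 1 m) :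
    dx 0 ᵍ⊗ₜ[K] 1 * ofPoly K m (alphaPart K m ω) + ofPoly K m (betaPart K m ω) = ω := by
  obtain ⟨ω, rfl⟩ := (GradedTensorProduct.of K (degreePart K 1) (degreePart K m)).surjective ω
  induction ω using TensorProduct.induction_on with
  | zero => simp
  | tmul a b =>
    change dx 0 ᵍ⊗ₜ[K] 1 * (Polynomial.aeval (x 0) (dsCoeff K a)) ᵍ⊗ₜ[K] b +
      (Polynomial.aeval (x 0) (constCoeff K a)) ᵍ⊗ₜ[K] b = a ᵍ⊗ₜ[K] b
    rw [tmul_mul_tmul _ _ _ _ SetLike.GradedOne.one_mem (aeval_mem _)]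
    simp only [mul_zero, pow_zero, one_smul, one_mul]
    rw [GradedTensorProduct.tmul, GradedTensorProduct.tmul, ← map_add, ← TensorProduct.add_tmul,
      eq_ds_mul_add]
  | add a b ha hb =>
    simp only [map_add, mul_add]
    conv_rhs => rw [← ha, ← hb]
    abel

variable (K) in
/-- The integral `∫₀¹ p(s) ds` of a polynomial. -/
def unitIntegral : Polynomial K →ₗ[K] K :=
  (Polynomial.basisMonomials K).constr K fun k => 1 / ((k : K) + 1)

variable (K) in
/-- Dupont's operator `h_j`: pull back along `((s, t₀), v) ↦ s e_j + t₀ v`, write the result as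
`ds ∧ α + β`, and integrate `α` over `0 ≤ s ≤ 1`. -/
def dupontVertex (j : Fin (m + 1)) : Omega K m →ₗ[K] Omega K m :=
  (TensorProduct.lid K (Omega K m)).toLinearMap ∘ₗ
    TensorProduct.map (unitIntegral K) LinearMap.id ∘ₗ alphaPart K m ∘ₗ
      (joinPullback K ![some j, none]).toLinearMap

variable (K) in
/-- The operator `h_f = h_{f(n)} ∘ ⋯ ∘ h_{f(0)}`. -/
def dupontFace (f : Fin (n + 1) ↪o Fin (m + 1)) : Omega K m →ₗ[K] Omega K m :=
  (List.ofFn fun i => (dupontVertex K (f i) : Module.End K (Omega K m))).reverse.prod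

variable (K) in
/-- Manetti's operator `k_f`: pull back along `((s, t₀, …, tₙ), v) ↦ s v + ∑ tᵢ e_{f(i)}`, then
integrate over the simplex with coordinates `(s, t₀, …, tₙ)`. -/
def manettiFace (f : Fin (n + 1) ↪o Fin (m + 1)) : Omega K m →ₗ[K] Omega K m :=
  contractLeft (integral K (n + 1)) ∘ₗ (joinPullback K (Fin.cons none fun i => some (f i))).toLinearMap

variable (K) in
/-- The Whitney elementary form
`ω_f = n! ∑ᵢ (-1)^i x_{f(i)} dx_{f(0)} ∧ … ∧ dx_{f(i-1)} ∧ dx_{f(i+1)} ∧ … ∧ dx_{f(n)}`. -/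
def whitney (f : Fin (n + 1) ↪o Fin (m + 1)) : Omega K m :=
  (n.factorial : K) • ∑ i : Fin (n + 1), (-1) ^ (i : ℕ) *
    (x (f i) * (List.ofFn fun j : Fin n => dx (f (i.succAbove j))).prod)

variable (K m) in
/-- Dupont's operator `h_m(η) = ∑ₙ ∑_f ω_f ∧ h_f(η)`, with `0 ≤ n ≤ m` and `f` ranging over the
strictly increasing maps from `{0, …, n}` to `{0, …, m}`. -/
def dupontOp : Omega K m →ₗ[K] Omega K m :=
  ∑ n ∈ Finset.range (m + 1), ∑ f : Fin (n + 1) ↪o Fin (m + 1),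
    LinearMap.mulLeft K (whitney K f) ∘ₗ dupontFace K f

variable (K m) in
/-- Manetti's operator `k_m(η) = ∑ₙ ∑_f ω_f ∧ k_f(η)`, with `0 ≤ n ≤ m` and `f` ranging over the
strictly increasing maps from `{0, …, n}` to `{0, …, m}`. -/
def manettiOp : Omega K m →ₗ[K] Omega K m :=
  ∑ n ∈ Finset.range (m + 1), ∑ f : Fin (n + 1) ↪o Fin (m + 1),
    LinearMap.mulLeft K (whitney K f) ∘ₗ manettiFace K f

end SimplexForms

end

/-!
Both `k_f` and `h_{(j)}` are contractions along a join: pull back along `(y, v) ↦ ∑ₐ yₐ Pₐ(v)`,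
where each `Pₐ` is either `v` or a vertex, and apply a functional to the forms in `y`. Contracting
first along the cone `((s, t), v) ↦ s e_j + t v` and then along a join amounts to contracting along
the join with `e_j` as an additional point, by the functional obtained from the cone structure of
the bigger simplex. So it suffices that `∫_{Δ^{N+1}}` is the functional obtained in this way from
`∫₀¹ ds` and `∫_{Δ^N}`. Both are homogeneous of top degree, hence determined by their values on the
forms `x₀^k₀ ⋯ x_{N+1}^k_{N+1} dx₁ ∧ ⋯ ∧ dx_{N+1}`, where the identity is the beta integral. Peeling
off the vertices `f(0), …, f(n)` one by one yields `k_f = h_f`.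
-/

noncomputable section

open scoped TensorProduct DirectSum

namespace SimplexForms

variable {K : Type*} [Field K] {n N m : ℕ}

theorem omega_induction {p : Omega K n → Prop} (one : p 1)
    (x_mul : ∀ i η, p η → p (x i * η)) (dx_mul : ∀ i η, p η → p (dx i * η))
    (add : ∀ a b, p a → p b → p (a + b)) (smul : ∀ (c : K) a, p a → p (c • a))
    (η : Omega K n) : p η := by
  obtain ⟨a, rfl⟩ : ∃ a, mk K n a = η := RingQuot.mkAlgHom_surjective K _ η
  suffices h : ∀ η, p η → p (mk K n a * η) by simpa using h 1 one
  induction a using FreeAlgebra.induction with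
  | grade0 r => exact fun η h => by simpa [← Algebra.smul_def] using smul r η h
  | grade1 g =>
    cases g with
    | inl i => exact x_mul i
    | inr i => exact dx_mul i
  | mul a b ha hb => exact fun η h => by simpa only [map_mul, mul_assoc] using ha _ (hb _ h)
  | add a b ha hb =>
    exact fun η h => by simpa only [map_add, add_mul] using add _ _ (ha _ h) (hb _ h)

theorem algHom_ext_x_dx {B : Type*} [Ring B] [Algebra K B] {φ ψ : Omega K n →ₐ[K] B}
    (hx : ∀ i, φ (x i) = ψ (x i)) (hdx : ∀ i, φ (dx i) = ψ (dx i)) : φ = ψ :=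
  algHom_ext (Sum.rec hx hdx)

section Scale

/-- The pull-back of forms by the fibrewise homothety of ratio `c` on tangent vectors: the algebra
endomorphism which multiplies the `p`-forms by `c ^ p`. For `c = -1` it carries the Koszul signs,
and for other `c` it detects degrees. -/
def scale (c : K) : Omega K n →ₐ[K] Omega K n :=
  lift x (fun i => c • dx i) x_comm
    (fun i j => by rw [mul_smul_comm, smul_mul_assoc, x_dx_comm])
    (fun i j => by rw [smul_mul_smul_comm, smul_mul_smul_comm, dx_anticomm, smul_neg])
    sum_x (by rw [← Finset.smul_sum, sum_dx, smul_zero])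

@[simp] theorem scale_x (c : K) (i : Fin (n + 1)) : scale c (x i : Omega K n) = x i :=
  lift_x _ _ _ _ _ _ _ i

@[simp] theorem scale_dx (c : K) (i : Fin (n + 1)) : scale c (dx i : Omega K n) = c • dx i :=
  lift_dx _ _ _ _ _ _ _ i

theorem scale_word (c : K) (w : List (Fin (n + 1) ⊕ Fin (n + 1))) :
    scale c (w.map gen).prod = c ^ w.countP Sum.isRight • ((w.map gen).prod : Omega K n) := by
  induction w with
  | nil => simp
  | cons g w ih =>
    cases g with
    | inl i =>
      change scale c (x i * (w.map gen).prod) = _ • (x i * (w.map gen).prod)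
      simp [ih]
    | inr i =>
      change scale c (dx i * (w.map gen).prod) = _ • (dx i * (w.map gen).prod)
      rw [map_mul, ih, scale_dx, smul_mul_smul_comm, ← pow_succ', List.countP_cons_of_pos rfl]

theorem scale_of_mem (c : K) {p : ℕ} {ω : Omega K n} (h : ω ∈ degreePart K n p) :
    scale c ω = c ^ p • ω := by
  refine LinearMap.eqOn_span (f := (scale c).toLinearMap) (g := c ^ p • LinearMap.id) ?_ h
  rintro _ ⟨w, rfl, rfl⟩
  exact scale_word c w

@[simp] theorem scale_one : scale (1 : K) = AlgHom.id K (Omega K n) :=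
  algHom_ext_x_dx (by simp) (by simp)

theorem scale_scale (c d : K) (ω : Omega K n) : scale c (scale d ω) = scale (c * d) ω := by
  have : (scale c).comp (scale d) = scale (n := n) (c * d) :=
    algHom_ext_x_dx (by simp) (by simp [smul_smul, mul_comm])
  exact DFunLike.congr_fun this ω

end Scale

section Functionals

/-- The functional `ω ↦ φ (a ∧ ω)`. -/
def mulDual (a : Omega K n) : Module.Dual K (Omega K n) →ₗ[K] Module.Dual K (Omega K n) :=
  (LinearMap.mulLeft K a).dualMap

/-- The functional `ω ↦ φ (scale c ω)`. -/
def scaleDual (c : K) : Module.Dual K (Omega K n) →ₗ[K] Module.Dual K (Omega K n) :=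
  (scale c).toLinearMap.dualMap

variable (φ : Module.Dual K (Omega K n))

@[simp] theorem mulDual_apply (a ω : Omega K n) : mulDual a φ ω = φ (a * ω) := rfl

@[simp] theorem scaleDual_apply (c : K) (ω : Omega K n) : scaleDual c φ ω = φ (scale c ω) := rfl

@[simp] theorem mulDual_one : mulDual 1 φ = φ := by ext; simp

theorem mulDual_mulDual (a b : Omega K n) : mulDual b (mulDual a φ) = mulDual (a * b) φ := by
  ext; simp [mul_assoc]

@[simp] theorem scaleDual_one : scaleDual 1 φ = φ := by ext; simp

theorem scaleDual_scaleDual (c d : K) : scaleDual c (scaleDual d φ) = scaleDual (c * d) φ := by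
  ext; simp [scale_scale, mul_comm]

theorem mulDual_x_scaleDual (c : K) (i : Fin (n + 1)) :
    mulDual (x i) (scaleDual c φ) = scaleDual c (mulDual (x i) φ) := by
  ext; simp

theorem mulDual_dx_scaleDual (c : K) (i : Fin (n + 1)) :
    mulDual (dx i) (scaleDual c φ) = c • scaleDual c (mulDual (dx i) φ) := by
  ext; simp

/-- A functional on forms is homogeneous of degree `d` if it only sees the `d`-forms. -/
def IsHomogeneous (φ : Module.Dual K (Omega K n)) (d : ℕ) : Prop :=
  ∀ ⦃p⦄, p ≠ d → ∀ ω ∈ degreePart K n p, φ ω = 0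

variable {φ}

theorem isHomogeneous_iff_scaleDual [CharZero K] {d : ℕ} :
    IsHomogeneous φ d ↔ ∀ c : K, scaleDual c φ = c ^ d • φ := by
  refine ⟨fun h c => DirectSum.decompose_lhom_ext (degreePart K n) fun p => ?_,
    fun h p hp ω hω => ?_⟩
  · ext ⟨ω, hω⟩
    simp only [LinearMap.comp_apply, Submodule.subtype_apply, scaleDual_apply, scale_of_mem c hω,
      map_smul, LinearMap.smul_apply]
    obtain rfl | hp := eq_or_ne p d
    · rfl
    · simp [h hp ω hω]
  · have h2 : (2 : K) ^ p * φ ω = 2 ^ d * φ ω := by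
      simpa [scale_of_mem 2 hω] using DFunLike.congr_fun (h 2) ω
    refine (mul_eq_mul_right_iff.mp h2).resolve_left fun h2 => hp ?_
    exact Nat.pow_right_injective le_rfl (by exact_mod_cast h2 : (2 : ℕ) ^ p = 2 ^ d)

end Functionals

section JoinContract

theorem contractLeft_tmul (φ : Module.Dual K (Omega K N)) (a : Omega K N) (b : Omega K m) :
    contractLeft φ (a ᵍ⊗ₜ[K] b : ProdForms K N m) = φ a • b := rfl

theorem contractLeft_tmul_mul (φ : Module.Dual K (Omega K N)) (a : Omega K N) {q : ℕ}
    {b : Omega K m} (hb : b ∈ degreePart K m q) (ω : ProdForms K N m) :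
    contractLeft φ (a ᵍ⊗ₜ[K] b * ω) = b * contractLeft (scaleDual ((-1) ^ q) (mulDual a φ)) ω := by
  suffices h : contractLeft φ ∘ₗ LinearMap.mulLeft K (a ᵍ⊗ₜ[K] b : ProdForms K N m) =
      LinearMap.mulLeft K b ∘ₗ contractLeft (scaleDual ((-1) ^ q) (mulDual a φ)) from
    DFunLike.congr_fun h ω
  refine GradedTensorProduct.hom_ext _ _ (TensorProduct.ext
    (DirectSum.decompose_lhom_ext (degreePart K N) fun p => ?_))
  ext ⟨a', ha'⟩ b'
  change contractLeft φ (a ᵍ⊗ₜ[K] b * a' ᵍ⊗ₜ[K] b') =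
    b * contractLeft (scaleDual ((-1) ^ q) (mulDual a φ)) (a' ᵍ⊗ₜ[K] b')
  rw [tmul_mul_tmul _ _ _ _ hb ha', contractLeft_tmul, scaleDual_apply, scale_of_mem _ ha',
    ← pow_mul]
  rcases Nat.even_or_odd (q * p) with h | h <;> simp [h.neg_one_pow, contractLeft_tmul]

/-- The contraction along a join: pull a form back along `(y, v) ↦ ∑ₐ yₐ Pₐ(v)` and apply a
functional to the forms in `y`. -/
def joinContract (P : Fin (N + 1) → Option (Fin (m + 1))) :
    Module.Dual K (Omega K N) →ₗ[K] Module.End K (Omega K m) where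
  toFun φ := contractLeft φ ∘ₗ (joinPullback K P).toLinearMap
  map_add' φ ψ := by
    simp only [contractLeft, TensorProduct.map_add_left, LinearMap.add_comp, LinearMap.comp_add]
  map_smul' c φ := by
    simp only [contractLeft, TensorProduct.map_smul_left, LinearMap.smul_comp, LinearMap.comp_smul,
      RingHom.id_apply]

variable (P : Fin (N + 1) → Option (Fin (m + 1))) (φ : Module.Dual K (Omega K N))

theorem joinContract_apply (η : Omega K m) :
    joinContract P φ η = contractLeft φ (joinPullback K P η) := rfl

theorem joinContract_one : joinContract P φ 1 = φ 1 • 1 := by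
  rw [joinContract_apply, map_one]
  exact contractLeft_tmul φ 1 1

theorem joinContract_x_mul (i : Fin (m + 1)) (η : Omega K m) :
    joinContract P φ (x i * η) =
      ∑ a, pointCoord (P a) i * joinContract P (mulDual (x a) φ) η := by
  simp only [joinContract_apply, map_mul, joinPullback, lift_x, joinCoord, Finset.sum_mul, map_sum]
  refine Finset.sum_congr rfl fun a _ => ?_
  rw [contractLeft_tmul_mul φ _ (pointCoord_mem _ _), pow_zero, scaleDual_one]

theorem joinContract_dx_mul (i : Fin (m + 1)) (η : Omega K m) :
    joinContract P φ (dx i * η) =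
      ∑ a, (pointCoord (P a) i * joinContract P (mulDual (dx a) φ) η +
        pointDiff (P a) i * joinContract P (scaleDual (-1) (mulDual (x a) φ)) η) := by
  simp only [joinContract_apply, map_mul, joinPullback, lift_dx, joinDiff, Finset.sum_mul, add_mul,
    map_sum, map_add]
  refine Finset.sum_congr rfl fun a _ => ?_
  rw [contractLeft_tmul_mul φ _ (pointCoord_mem _ _), pow_zero, scaleDual_one,
    contractLeft_tmul_mul φ _ (pointDiff_mem _ _), pow_one]

theorem joinContract_scale (c : K) (η : Omega K m) :
    joinContract P φ (scale c η) = scale c (joinContract P (scaleDual c φ) η) := by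
  induction η using omega_induction generalizing φ with
  | one => simp [joinContract_one]
  | x_mul i η h =>
    simp only [map_mul, scale_x, joinContract_x_mul, map_sum, h,
      scale_of_mem c (pointCoord_mem _ _), pow_zero, one_smul, mulDual_x_scaleDual]
  | dx_mul i η h =>
    simp only [map_mul, map_add, scale_dx, smul_mul_assoc, map_smul, joinContract_dx_mul, map_sum,
      h, Finset.smul_sum, smul_add, scale_of_mem c (pointCoord_mem _ _), pow_zero, one_smul,
      scale_of_mem c (pointDiff_mem _ _), pow_one, mulDual_x_scaleDual, mulDual_dx_scaleDual,
      mul_smul_comm, LinearMap.smul_apply, scaleDual_scaleDual, mul_comm c]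
  | add a b ha hb => simp only [map_add, ha, hb]
  | smul r a ha => simp only [map_smul, ha]

theorem joinContract_of_none {P : Fin 1 → Option (Fin (m + 1))} (hP : P 0 = none)
    (φ : Module.Dual K (Omega K 0)) (η : Omega K m) : joinContract P φ η = φ 1 • η := by
  have x_zero : (x 0 : Omega K 0) = 1 := by simpa using sum_x (K := K) (n := 0)
  have dx_zero : (dx 0 : Omega K 0) = 0 := by simpa using sum_dx (K := K) (n := 0)
  induction η using omega_induction generalizing φ with
  | one => simp [joinContract_one]
  | x_mul i η h => simp [joinContract_x_mul, h, hP, x_zero, pointCoord]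
  | dx_mul i η h => simp [joinContract_dx_mul, h, hP, x_zero, dx_zero, pointDiff]
  | add a b ha hb => simp only [map_add, ha, hb, smul_add]
  | smul r a ha => simp only [map_smul, ha, smul_comm r]

end JoinContract

section Cone

variable (K) in
/-- The restriction of forms to the face opposite to the vertex `v`. -/
def restrictFace (v : Fin (N + 2)) : Omega K (N + 1) →ₐ[K] Omega K N :=
  lift (Fin.insertNth (α := fun _ => Omega K N) v 0 x)
    (Fin.insertNth (α := fun _ => Omega K N) v 0 dx)
    (by simp [Fin.forall_iff_succAbove v, x_comm])
    (by simp [Fin.forall_iff_succAbove v, x_dx_comm])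
    (by simpa [Fin.forall_iff_succAbove v] using dx_anticomm)
    (by simp [Fin.sum_univ_succAbove _ v, sum_x])
    (by simp [Fin.sum_univ_succAbove _ v, sum_dx])

@[simp] theorem restrictFace_x_same (v : Fin (N + 2)) : restrictFace K v (x v) = 0 := by
  rw [restrictFace, lift_x, Fin.insertNth_apply_same]

@[simp] theorem restrictFace_dx_same (v : Fin (N + 2)) : restrictFace K v (dx v) = 0 := by
  rw [restrictFace, lift_dx, Fin.insertNth_apply_same]

@[simp] theorem restrictFace_x_succAbove (v : Fin (N + 2)) (b : Fin (N + 1)) :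
    restrictFace K v (x (v.succAbove b)) = x b := by
  rw [restrictFace, lift_x, Fin.insertNth_apply_succAbove]

@[simp] theorem restrictFace_dx_succAbove (v : Fin (N + 2)) (b : Fin (N + 1)) :
    restrictFace K v (dx (v.succAbove b)) = dx b := by
  rw [restrictFace, lift_dx, Fin.insertNth_apply_succAbove]

theorem restrictFace_scale (v : Fin (N + 2)) (c : K) (ω : Omega K (N + 1)) :
    restrictFace K v (scale c ω) = scale c (restrictFace K v ω) := by
  have : (restrictFace K v).comp (scale c) = (scale c).comp (restrictFace K v) :=
    algHom_ext_x_dx (by simp [Fin.forall_iff_succAbove v]) (by simp [Fin.forall_iff_succAbove v])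
  exact DFunLike.congr_fun this ω

theorem joinContract_cone_x_mul (j i : Fin (m + 1)) (φ : Module.Dual K (Omega K 1))
    (η : Omega K m) :
    joinContract ![some j, none] φ (x i * η) =
      (if i = j then joinContract ![some j, none] (mulDual (x 0) φ) η else 0) +
        x i * joinContract ![some j, none] (mulDual (x 1) φ) η := by
  simp [joinContract_x_mul, pointCoord]

theorem joinContract_cone_dx_mul (j i : Fin (m + 1)) (φ : Module.Dual K (Omega K 1))
    (η : Omega K m) :
    joinContract ![some j, none] φ (dx i * η) =
      (if i = j then joinContract ![some j, none] (mulDual (dx 0) φ) η else 0) +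
        (x i * joinContract ![some j, none] (mulDual (dx 1) φ) η +
          dx i * joinContract ![some j, none] (scaleDual (-1) (mulDual (x 1) φ)) η) := by
  simp [joinContract_dx_mul, pointCoord, pointDiff]

/-- The simplex is the cone with apex `v` over the opposite face, by `((s, t), y) ↦ s e_v + t y`.
This is the functional on its forms which applies `φ` to the forms in `(s, t)` and `ψ` to the forms
in `y`. -/
def coneFunctional (v : Fin (N + 2)) (φ : Module.Dual K (Omega K 1))
    (ψ : Module.Dual K (Omega K N)) : Module.Dual K (Omega K (N + 1)) :=
  ψ ∘ₗ (restrictFace K v).toLinearMap ∘ₗ joinContract ![some v, none] φ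

variable (v : Fin (N + 2)) (φ : Module.Dual K (Omega K 1)) (ψ : Module.Dual K (Omega K N))

theorem coneFunctional_apply (ω : Omega K (N + 1)) :
    coneFunctional v φ ψ ω = ψ (restrictFace K v (joinContract ![some v, none] φ ω)) := rfl

theorem coneFunctional_one : coneFunctional v φ ψ 1 = φ 1 * ψ 1 := by
  simp [coneFunctional_apply, joinContract_one]

theorem coneFunctional_zero_left : coneFunctional v 0 ψ = 0 := by
  ext
  simp [coneFunctional_apply]

theorem mulDual_x_same_coneFunctional :
    mulDual (x v) (coneFunctional v φ ψ) = coneFunctional v (mulDual (x 0) φ) ψ := by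
  ext
  simp [coneFunctional_apply, joinContract_cone_x_mul]

theorem mulDual_x_succAbove_coneFunctional (b : Fin (N + 1)) :
    mulDual (x (v.succAbove b)) (coneFunctional v φ ψ) =
      coneFunctional v (mulDual (x 1) φ) (mulDual (x b) ψ) := by
  ext
  simp [coneFunctional_apply, joinContract_cone_x_mul]

theorem mulDual_dx_same_coneFunctional :
    mulDual (dx v) (coneFunctional v φ ψ) = coneFunctional v (mulDual (dx 0) φ) ψ := by
  ext
  simp [coneFunctional_apply, joinContract_cone_dx_mul]

theorem mulDual_dx_succAbove_coneFunctional (b : Fin (N + 1)) :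
    mulDual (dx (v.succAbove b)) (coneFunctional v φ ψ) =
      coneFunctional v (mulDual (dx 1) φ) (mulDual (x b) ψ) +
        coneFunctional v (scaleDual (-1) (mulDual (x 1) φ)) (mulDual (dx b) ψ) := by
  ext
  simp [coneFunctional_apply, joinContract_cone_dx_mul]

theorem scaleDual_coneFunctional (c : K) :
    scaleDual c (coneFunctional v φ ψ) = coneFunctional v (scaleDual c φ) (scaleDual c ψ) := by
  ext
  simp [coneFunctional_apply, joinContract_scale, restrictFace_scale]

variable {v φ ψ} in
theorem IsHomogeneous.coneFunctional [CharZero K] {d e : ℕ} (hφ : IsHomogeneous φ d)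
    (hψ : IsHomogeneous ψ e) : IsHomogeneous (coneFunctional v φ ψ) (e + d) := by
  rw [isHomogeneous_iff_scaleDual] at *
  intro c
  ext ω
  simp only [scaleDual_coneFunctional, hφ, hψ, coneFunctional_apply, map_smul,
    LinearMap.smul_apply, smul_smul, pow_add, mul_comm]

/-- Both sides pull back along `((s, t), y, u) ↦ s e_j + t ∑ₐ yₐ P_{v.succAbove a}(u)`. -/
theorem joinContract_joinContract_cone {P : Fin (N + 2) → Option (Fin (m + 1))}
    {j : Fin (m + 1)} (hP : P v = some j) (η : Omega K m) :
    joinContract (P ∘ v.succAbove) ψ (joinContract ![some j, none] φ η) =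
      joinContract P (coneFunctional v φ ψ) η := by
  induction η using omega_induction generalizing φ ψ with
  | one => simp [joinContract_one, coneFunctional_one, smul_smul]
  | x_mul i η h =>
    rw [joinContract_cone_x_mul]
    simp only [joinContract_x_mul, map_add, Fin.sum_univ_succAbove _ v,
      mulDual_x_same_coneFunctional, mulDual_x_succAbove_coneFunctional, ← h, hP, pointCoord,
      Option.elim_some, ite_mul, one_mul, zero_mul, apply_ite (joinContract _ ψ), map_zero,
      Function.comp_apply]
  | dx_mul i η h =>
    rw [joinContract_cone_dx_mul]
    simp only [joinContract_x_mul, joinContract_dx_mul, map_add,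
      Fin.sum_univ_succAbove _ v, ← Finset.sum_add_distrib, mulDual_x_same_coneFunctional,
      mulDual_x_succAbove_coneFunctional, mulDual_dx_same_coneFunctional,
      mulDual_dx_succAbove_coneFunctional, scaleDual_coneFunctional, LinearMap.add_apply, mul_add,
      ← h, hP, pointCoord, pointDiff, Option.elim_some, ite_mul, one_mul, zero_mul, add_zero,
      apply_ite (joinContract _ ψ), map_zero, Function.comp_apply, add_assoc]
  | add a b ha hb => simp only [map_add, ha, hb]
  | smul r a ha => simp only [map_smul, ha]

end Cone

section TopDegree

open scoped IsMulCommutative in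
variable (K n) in
/-- The polynomial functions on the simplex, as `0`-forms. -/
def xPoly : MvPolynomial (Fin (n + 1)) K →ₐ[K] Omega K n :=
  haveI : IsMulCommutative (Algebra.adjoin K (Set.range (x : Fin (n + 1) → Omega K n))) :=
    Algebra.isMulCommutative_adjoin K (by rintro _ ⟨i, rfl⟩ _ ⟨j, rfl⟩; exact x_comm i j)
  (Algebra.adjoin K (Set.range x)).val.comp
    (MvPolynomial.aeval fun i => ⟨x i, Algebra.subset_adjoin ⟨i, rfl⟩⟩)

@[simp] theorem xPoly_X (i : Fin (n + 1)) : xPoly K n (.X i) = x i := by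
  simp [xPoly]

theorem xPoly_prod_X_pow (k : Fin (n + 1) → ℕ) :
    xPoly K n (∏ j, .X j ^ k j) = (List.ofFn fun j => x j ^ k j).prod := by
  rw [← List.prod_ofFn, map_list_prod, List.map_ofFn]
  simp [Function.comp_def]

theorem xPoly_mem_adjoin (p : MvPolynomial (Fin (n + 1)) K) :
    xPoly K n p ∈ Algebra.adjoin K (Set.range x) :=
  SetLike.coe_mem _

theorem xPoly_mem (p : MvPolynomial (Fin (n + 1)) K) : xPoly K n p ∈ degreePart K n 0 := by
  have : Algebra.adjoin K (Set.range x) ≤ SetLike.GradeZero.subalgebra (degreePart K n) :=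
    Algebra.adjoin_le (Set.range_subset_iff.mpr x_mem)
  exact this (xPoly_mem_adjoin p)

theorem commute_xPoly_dx (p : MvPolynomial (Fin (n + 1)) K) (i : Fin (n + 1)) :
    Commute (xPoly K n p) (dx i) := by
  refine (Algebra.commute_of_mem_adjoin_of_forall_mem_commute (xPoly_mem_adjoin p) ?_).symm
  rintro _ ⟨j, rfl⟩
  exact (x_dx_comm j i).symm

variable (K n) in
/-- The `1`-forms with constant coefficients in the frame `dx₁, …, dxₙ`. -/
def constOneForm : (Fin n → K) →ₗ[K] Omega K n :=
  Fintype.linearCombination K fun j => dx j.succ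

@[simp] theorem constOneForm_single (j : Fin n) : constOneForm K n (Pi.single j 1) = dx j.succ := by
  simp [constOneForm]

theorem constOneForm_one : constOneForm K n 1 = -dx 0 := by
  rw [eq_neg_of_add_eq_zero_left ((Fin.sum_univ_succ _).symm.trans (sum_dx (K := K) (n := n)))]
  simp [constOneForm, Fintype.linearCombination_apply]

theorem constOneForm_mem (v : Fin n → K) : constOneForm K n v ∈ degreePart K n 1 := by
  rw [constOneForm, Fintype.linearCombination_apply]
  exact sum_mem fun j _ => Submodule.smul_mem _ _ (dx_mem _)

theorem commute_xPoly_constOneForm (p : MvPolynomial (Fin (n + 1)) K) (v : Fin n → K) :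
    Commute (xPoly K n p) (constOneForm K n v) := by
  rw [constOneForm, Fintype.linearCombination_apply]
  exact Commute.sum_right _ _ _ fun j _ => (commute_xPoly_dx p _).smul_right _

theorem constOneForm_anticomm (v w : Fin n → K) :
    constOneForm K n v * constOneForm K n w = -(constOneForm K n w * constOneForm K n v) := by
  simp only [constOneForm, Fintype.linearCombination_apply, Finset.sum_mul_sum,
    ← Finset.sum_neg_distrib]
  rw [Finset.sum_comm]
  refine Finset.sum_congr rfl fun i _ => Finset.sum_congr rfl fun j _ => ?_
  rw [smul_mul_smul_comm, smul_mul_smul_comm, dx_anticomm, smul_neg, mul_comm]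

theorem constOneForm_mul_self [CharZero K] (v : Fin n → K) :
    constOneForm K n v * constOneForm K n v = 0 := by
  have : (2 : K) • (constOneForm K n v * constOneForm K n v) = 0 := by
    rw [two_smul]
    exact eq_neg_iff_add_eq_zero.mp (constOneForm_anticomm v v)
  exact (smul_eq_zero.mp this).resolve_left two_ne_zero

variable [CharZero K]

variable (K n) in
/-- The forms with constant coefficients in the frame `dx₁, …, dxₙ`. -/
def constForm : ExteriorAlgebra K (Fin n → K) →ₐ[K] Omega K n :=
  ExteriorAlgebra.lift K ⟨constOneForm K n, constOneForm_mul_self⟩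

@[simp] theorem constForm_ι (v : Fin n → K) :
    constForm K n (ExteriorAlgebra.ι K v) = constOneForm K n v :=
  ExteriorAlgebra.lift_ι_apply K _ _ v

theorem constForm_ιMulti {l : ℕ} (v : Fin l → Fin n → K) :
    constForm K n (ExteriorAlgebra.ιMulti K l v) =
      (List.ofFn fun i => constOneForm K n (v i)).prod := by
  rw [ExteriorAlgebra.ιMulti_apply, map_list_prod, List.map_ofFn]
  simp [Function.comp_def]

theorem constForm_ιMulti_mem {l : ℕ} (v : Fin l → Fin n → K) :
    constForm K n (ExteriorAlgebra.ιMulti K l v) ∈ degreePart K n l := by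
  rw [constForm_ιMulti]
  simpa using SetLike.list_prod_ofFn_mem_graded (A := degreePart K n) (fun _ => 1) _
    fun i => constOneForm_mem (v i)

theorem commute_xPoly_constForm (p : MvPolynomial (Fin (n + 1)) K)
    (w : ExteriorAlgebra K (Fin n → K)) : Commute (xPoly K n p) (constForm K n w) := by
  induction w using ExteriorAlgebra.induction with
  | algebraMap r =>
    exact (AlgHom.commutes (constForm K n) r).symm ▸ Algebra.commute_algebraMap_right r _
  | ι v => exact (constForm_ι v).symm ▸ commute_xPoly_constOneForm p v
  | mul a b ha hb => exact (map_mul (constForm K n) a b).symm ▸ ha.mul_right hb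
  | add a b ha hb => exact (map_add (constForm K n) a b).symm ▸ ha.add_right hb

variable (K n) in
/-- The form `∑ pᵢ wᵢ` with polynomial coefficients `pᵢ` and constant forms `wᵢ`. -/
def coeffForm : MvPolynomial (Fin (n + 1)) K ⊗[K] ExteriorAlgebra K (Fin n → K) →ₐ[K] Omega K n :=
  Algebra.TensorProduct.lift (xPoly K n) (constForm K n) commute_xPoly_constForm

theorem coeffForm_surjective : Function.Surjective (coeffForm K n) := by
  intro η
  change η ∈ (coeffForm K n).range
  induction η using omega_induction with
  | one => exact one_mem _
  | x_mul i η h => exact mul_mem ⟨.X i ⊗ₜ 1, by simp [coeffForm]⟩ h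
  | dx_mul i η h =>
    refine mul_mem ?_ h
    cases i using Fin.cases with
    | zero => exact ⟨1 ⊗ₜ ExteriorAlgebra.ι K (-1), by simp [coeffForm, constOneForm_one]⟩
    | succ j => exact ⟨1 ⊗ₜ ExteriorAlgebra.ι K (Pi.single j 1), by simp [coeffForm]⟩
  | add a b ha hb => exact add_mem ha hb
  | smul c a ha => exact Subalgebra.smul_mem _ ha c

/-- The reason is that an alternating map of `n` vectors in `Kⁿ` is determined by its value on a
basis. -/
theorem IsHomogeneous.ext_top {φ ψ : Module.Dual K (Omega K n)} (hφ : IsHomogeneous φ n)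
    (hψ : IsHomogeneous ψ n)
    (h : ∀ k : Fin (n + 1) → ℕ,
      φ (xPoly K n (∏ j, .X j ^ k j) * (List.ofFn fun j : Fin n => dx j.succ).prod) =
        ψ (xPoly K n (∏ j, .X j ^ k j) * (List.ofFn fun j : Fin n => dx j.succ).prod)) :
    φ = ψ := by
  suffices hc : φ ∘ₗ (coeffForm K n).toLinearMap = ψ ∘ₗ (coeffForm K n).toLinearMap from
    (LinearMap.cancel_right coeffForm_surjective).mp hc
  refine TensorProduct.ext (MvPolynomial.linearMap_ext fun k => LinearMap.ext_ring
    (ExteriorAlgebra.lhom_ext fun l => ?_))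
  obtain rfl | hl := eq_or_ne l n
  · let b := Pi.basisFun K (Fin l)
    refine (AlternatingMap.eq_smul_basis_det b _).trans
      (.trans (congrArg (· • b.det) ?_) (AlternatingMap.eq_smul_basis_det b _).symm)
    simpa [b, coeffForm, constForm_ιMulti, MvPolynomial.monomial_eq, Finsupp.prod_fintype] using h k
  · ext v
    have hmem : coeffForm K n (.monomial k 1 ⊗ₜ ExteriorAlgebra.ιMulti K l v) ∈
        degreePart K n l := by
      simpa [coeffForm] using
        SetLike.mul_mem_graded (xPoly_mem (.monomial k 1)) (constForm_ιMulti_mem v)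
    exact (hφ hl _ hmem).trans (hψ hl _ hmem).symm

end TopDegree

section Integral

theorem isHomogeneous_integral : IsHomogeneous (integral K n) n :=
  fun _ hp _ hω => integral_eq_zero hp hω

@[simp] theorem integral_zero_one [CharZero K] : integral K 0 1 = 1 := by
  simpa using integral_monomial (K := K) (0 : Fin 1 → ℕ) 0

variable (K) in
/-- The integral over `0 ≤ s ≤ 1` of a form on the `1`-simplex with coordinates `(s, 1 - s)`. -/
def dsIntegral : Module.Dual K (Omega K 1) := unitIntegral K ∘ₗ dsCoeff K

@[simp] theorem intervalChart_x_zero : intervalChart K (x 0) = TrivSqZeroExt.inl Polynomial.X :=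
  lift_x _ _ _ _ _ _ _ 0

@[simp] theorem intervalChart_x_one :
    intervalChart K (x 1) = TrivSqZeroExt.inl (1 - Polynomial.X) :=
  lift_x _ _ _ _ _ _ _ 1

@[simp] theorem intervalChart_dx_zero : intervalChart K (dx 0) = TrivSqZeroExt.inr 1 :=
  lift_dx _ _ _ _ _ _ _ 0

@[simp] theorem intervalChart_dx_one : intervalChart K (dx 1) = TrivSqZeroExt.inr (-1) :=
  lift_dx _ _ _ _ _ _ _ 1

theorem intervalChart_scale (c : K) (ω : Omega K 1) :
    intervalChart K (scale c ω) =
      TrivSqZeroExt.map (c • LinearMap.id) (intervalChart K ω) := by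
  have : (intervalChart K).comp (scale c) =
      ((TrivSqZeroExt.map (c • LinearMap.id)).restrictScalars K).comp (intervalChart K) :=
    algHom_ext_x_dx (by simp [Fin.forall_fin_two])
      (by simp [Fin.forall_fin_two, TrivSqZeroExt.ext_iff])
  exact DFunLike.congr_fun this ω

theorem isHomogeneous_dsIntegral [CharZero K] : IsHomogeneous (dsIntegral K) 1 := by
  refine isHomogeneous_iff_scaleDual.mpr fun c => LinearMap.ext fun ω => ?_
  change unitIntegral K (intervalChart K (scale c ω)).snd = _
  rw [intervalChart_scale, TrivSqZeroExt.snd_map]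
  simp [dsIntegral, dsCoeff]

theorem unitIntegral_X_pow (a : ℕ) : unitIntegral K (.X ^ a) = 1 / ((a : K) + 1) := by
  simpa [unitIntegral, Polynomial.monomial_one_right_eq_X_pow] using
    (Polynomial.basisMonomials K).constr_basis K (fun k : ℕ => 1 / ((k : K) + 1)) a

theorem unitIntegral_eq_polyIntegral [CharZero K] :
    unitIntegral K =
      polyIntegral K 1 ∘ₗ (Polynomial.aeval (MvPolynomial.X (R := K) (0 : Fin 1))).toLinearMap := by
  ext a
  have hfac : (a.factorial : K) ≠ 0 := Nat.cast_ne_zero.mpr a.factorial_ne_zero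
  have hpoly : polyIntegral K 1 (.X 0 ^ a) = a.factorial / (a + 1).factorial := by
    simpa [MvPolynomial.X_pow_eq_monomial] using
      polyIntegral_monomial (K := K) (Finsupp.single (0 : Fin 1) a)
  suffices 1 / ((a : K) + 1) = a.factorial / (a + 1).factorial by
    simpa [unitIntegral_X_pow, Polynomial.monomial_one_right_eq_X_pow, hpoly] using this
  rw [Nat.factorial_succ]
  push_cast
  field_simp

theorem unitIntegral_X_pow_mul [CharZero K] (a b : ℕ) :
    unitIntegral K (.X ^ a * (1 - .X) ^ b) =
      (a.factorial * b.factorial : K) / ((a + b + 1).factorial : K) := by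
  have := polyIntegral_pow (K := K) b (Finsupp.single (0 : Fin 1) a)
  rw [← MvPolynomial.X_pow_eq_monomial] at this
  simpa [unitIntegral_eq_polyIntegral, mul_comm, add_comm a] using this

theorem dsIntegral_monomial [CharZero K] (a b : ℕ) :
    dsIntegral K (x 0 ^ a * x 1 ^ b * dx 0) =
      (a.factorial * b.factorial : K) / ((a + b + 1).factorial : K) := by
  rw [← unitIntegral_X_pow_mul]
  simp [dsIntegral, dsCoeff]

end Integral

section ConeIntegral

theorem mulDual_x_same_pow_coneFunctional (v : Fin (N + 2)) (φ : Module.Dual K (Omega K 1))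
    (ψ : Module.Dual K (Omega K N)) (k : ℕ) :
    mulDual (x v ^ k) (coneFunctional v φ ψ) = coneFunctional v (mulDual (x 0 ^ k) φ) ψ := by
  induction k generalizing φ with
  | zero => simp
  | succ k ih =>
    rw [pow_succ', ← mulDual_mulDual, mulDual_x_same_coneFunctional, ih, mulDual_mulDual, pow_succ']

theorem mulDual_x_succAbove_pow_coneFunctional (v : Fin (N + 2)) (b : Fin (N + 1))
    (φ : Module.Dual K (Omega K 1)) (ψ : Module.Dual K (Omega K N)) (k : ℕ) :
    mulDual (x (v.succAbove b) ^ k) (coneFunctional v φ ψ) =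
      coneFunctional v (mulDual (x 1 ^ k) φ) (mulDual (x b ^ k) ψ) := by
  induction k generalizing φ ψ with
  | zero => simp
  | succ k ih =>
    rw [pow_succ', ← mulDual_mulDual, mulDual_x_succAbove_coneFunctional, ih, mulDual_mulDual,
      mulDual_mulDual, pow_succ', pow_succ']

theorem mulDual_xPoly_succAbove_coneFunctional (v : Fin (N + 2)) (s : Finset (Fin (N + 1)))
    (k : Fin (N + 1) → ℕ) (φ : Module.Dual K (Omega K 1)) (ψ : Module.Dual K (Omega K N)) :
    mulDual (xPoly K (N + 1) (∏ b ∈ s, .X (v.succAbove b) ^ k b)) (coneFunctional v φ ψ) =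
      coneFunctional v (mulDual (x 1 ^ ∑ b ∈ s, k b) φ)
        (mulDual (xPoly K N (∏ b ∈ s, .X b ^ k b)) ψ) := by
  induction s using Finset.induction_on generalizing φ ψ with
  | empty => simp
  | insert b s hb ih =>
    simp only [Finset.prod_insert hb, Finset.sum_insert hb, map_mul, map_pow, xPoly_X, pow_add,
      ← mulDual_mulDual, mulDual_x_succAbove_pow_coneFunctional, ih]

theorem mulDual_xPoly_coneFunctional (v : Fin (N + 2)) (k : Fin (N + 2) → ℕ)
    (φ : Module.Dual K (Omega K 1)) (ψ : Module.Dual K (Omega K N)) :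
    mulDual (xPoly K (N + 1) (∏ j, .X j ^ k j)) (coneFunctional v φ ψ) =
      coneFunctional v (mulDual (x 0 ^ k v * x 1 ^ ∑ b, k (v.succAbove b)) φ)
        (mulDual (xPoly K N (∏ b, .X b ^ k (v.succAbove b))) ψ) := by
  rw [Fin.prod_univ_succAbove _ v, map_mul, map_pow, xPoly_X, ← mulDual_mulDual,
    mulDual_x_same_pow_coneFunctional,
    mulDual_xPoly_succAbove_coneFunctional v _ (fun b => k (v.succAbove b)), mulDual_mulDual]

theorem coneFunctional_prod_dx_succAbove (v : Fin (N + 2)) {l : ℕ} (c : Fin l → Fin (N + 1))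
    {φ : Module.Dual K (Omega K 1)} (hφ : mulDual (dx 1) φ = 0) (ψ : Module.Dual K (Omega K N)) :
    coneFunctional v φ ψ (List.ofFn fun i => dx (v.succAbove (c i))).prod =
      φ (x 1 ^ l) * ψ (List.ofFn fun i => dx (c i)).prod := by
  induction l generalizing φ ψ with
  | zero => simp [coneFunctional_one]
  | succ l ih =>
    have hφ' : mulDual (dx 1) (scaleDual (-1) (mulDual (x 1) φ)) = 0 := by
      rw [mulDual_dx_scaleDual, mulDual_mulDual, x_dx_comm, ← mulDual_mulDual, hφ, map_zero,
        map_zero, smul_zero]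
    rw [List.ofFn_succ, List.prod_cons, ← mulDual_apply, mulDual_dx_succAbove_coneFunctional, hφ,
      coneFunctional_zero_left, zero_add, ih (fun i => c i.succ) hφ', List.ofFn_succ,
      List.prod_cons]
    simp [pow_succ']

variable [CharZero K]

theorem dx_zero_mul_dx_one : (dx 0 * dx 1 : Omega K 1) = 0 := by
  have h : (dx 0 + dx 1 : Omega K 1) = 0 := by simpa using sum_dx (K := K) (n := 1)
  rw [← neg_eq_of_add_eq_zero_right h, mul_neg, dx_mul_self, neg_zero]

/-- Every `dx (v.succAbove b)` contributes the factor `t` of `((s, t), y) ↦ s e_v + t y`; its `dt`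
is killed by `dx v`, which is `ds`. -/
theorem coneFunctional_monomial (v : Fin (N + 2)) (k : Fin (N + 2) → ℕ) {l : ℕ}
    (c : Fin l → Fin (N + 1)) (φ : Module.Dual K (Omega K 1)) (ψ : Module.Dual K (Omega K N)) :
    coneFunctional v φ ψ (xPoly K (N + 1) (∏ j, .X j ^ k j) *
        (dx v * (List.ofFn fun i => dx (v.succAbove (c i))).prod)) =
      φ (x 0 ^ k v * x 1 ^ (∑ b, k (v.succAbove b) + l) * dx 0) *
        ψ (xPoly K N (∏ b, .X b ^ k (v.succAbove b)) * (List.ofFn fun i => dx (c i)).prod) := by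
  have hdx (a : Omega K 1) : mulDual (dx 1) (mulDual (a * dx 0) φ) = 0 := by
    rw [mulDual_mulDual, mul_assoc, dx_zero_mul_dx_one]
    ext
    simp
  have hcomm : Commute (x 1 ^ l) (dx 0 : Omega K 1) := Commute.pow_left (x_dx_comm 1 0) l
  rw [← mulDual_apply, ← mulDual_apply, mulDual_xPoly_coneFunctional,
    mulDual_dx_same_coneFunctional, mulDual_mulDual, coneFunctional_prod_dx_succAbove v c (hdx _),
    mulDual_apply, mulDual_apply, mul_assoc, ← hcomm.eq, pow_add]
  simp only [mul_assoc]

theorem integral_xPoly_mul (k : Fin (n + 1) → ℕ) :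
    integral K n (xPoly K n (∏ j, .X j ^ k j) * (List.ofFn fun j : Fin n => dx j.succ).prod) =
      (∏ j, ((k j).factorial : K)) / ((∑ j, k j + n).factorial : K) := by
  simpa [xPoly_prod_X_pow] using integral_monomial k 0

theorem coneFunctional_integral :
    coneFunctional 1 (dsIntegral K) (integral K N) = integral K (N + 1) := by
  refine (isHomogeneous_dsIntegral.coneFunctional isHomogeneous_integral).ext_top
    isHomogeneous_integral fun k => ?_
  have hfac : ((∑ b, k ((1 : Fin (N + 2)).succAbove b) + N).factorial : K) ≠ 0 :=
    Nat.cast_ne_zero.mpr (Nat.factorial_ne_zero _)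
  rw [integral_xPoly_mul, List.ofFn_succ, List.prod_cons, Fin.succ_zero_eq_one]
  simp only [← Fin.one_succAbove_succ]
  rw [coneFunctional_monomial, integral_xPoly_mul, dsIntegral_monomial,
    Fin.prod_univ_succAbove _ (1 : Fin (N + 2)), Fin.sum_univ_succAbove _ (1 : Fin (N + 2)),
    ← add_assoc, ← add_assoc]
  field_simp

end ConeIntegral

section Comparison

theorem dupontVertex_eq_joinContract (j : Fin (m + 1)) :
    dupontVertex K j = joinContract ![some j, none] (dsIntegral K) := by
  have : contractLeft (dsIntegral K) = (TensorProduct.lid K (Omega K m)).toLinearMap ∘ₗ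
      TensorProduct.map (unitIntegral K) LinearMap.id ∘ₗ alphaPart K m :=
    GradedTensorProduct.hom_ext _ _ (TensorProduct.ext' fun _ _ => rfl)
  refine LinearMap.ext fun η => ?_
  rw [joinContract_apply, this]
  rfl

theorem joinContract_integral_eq_prod [CharZero K] (J : Fin n → Fin (m + 1)) :
    joinContract (Fin.cons none fun i => some (J i)) (integral K n) =
      (List.ofFn fun i => (dupontVertex K (J i) : Module.End K (Omega K m))).reverse.prod := by
  refine LinearMap.ext fun η => ?_
  induction n generalizing η with
  | zero => simp [joinContract_of_none]
  | succ n ih =>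
    let P : Fin (n + 2) → Option (Fin (m + 1)) := Fin.cons none fun i => some (J i)
    have hP : P ∘ (1 : Fin (n + 2)).succAbove = Fin.cons none fun i => some (J i.succ) := by
      funext a
      cases a using Fin.cases <;> simp [P]
    rw [List.ofFn_succ, List.reverse_cons, List.prod_append, List.prod_singleton,
      Module.End.mul_apply, ← ih, dupontVertex_eq_joinContract, ← hP,
      joinContract_joinContract_cone 1 _ _ (P := P) (j := J 0) rfl, coneFunctional_integral]

theorem manettiFace_eq_dupontFace [CharZero K] (f : Fin (n + 1) ↪o Fin (m + 1)) :
    manettiFace K f = dupontFace K f :=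
  joinContract_integral_eq_prod fun i => f i

end Comparison

end SimplexForms

end

/-- Manetti's operator and Dupont's operator on polynomial differential forms coincide. -/
theorem theorem4p1 (K : Type*) [Field K] [CharZero K] (m : ℕ) :
    SimplexForms.manettiOp K m = SimplexForms.dupontOp K m := by
  simp only [SimplexForms.manettiOp, SimplexForms.dupontOp,
    SimplexForms.manettiFace_eq_dupontFace]
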